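/- All graphs are finite, simple and undirected. A tree-decomposition of a graph $G$ is a family $(B_x : x\in V(T))$ of subsets of $V(G)$ (bags), indexed by the nodes of a tree $T$, such that for every edge $uv$ of $G$ some bag contains both $u$ and $v$, and for every vertex $v$ of $G$ the set $\{x\in V(T) : v\in B_x\}$ induces a non-empty connected subtree of $T$. Its width is $\max_x |B_x| - 1$, and the treewidth of $G$ is the minimum width of a tree-decomposition of $G$. An $n$-colouring of $G$ assigns to each vertex one of $n$ colours; a monochromatic component is a connected component of the subgraph of $G$ induced by the vertices of one colour. A colouring has defect $d$ if every monochromatic component has maximum degree at most $d$, and clustering $c$ if every monochromatic component has at most $c$ vertices. For a class $\mathcal{G}$ of graphs, the defective chromatic number $\chi_{\Delta}(\mathcal{G})$ (respectively, the clustered chromatic number $\chi_{\star}(\mathcal{G})$) is the minimum integer $n$ for which there is an integer $d$ (respectively, $c$) such that every graph in $\mathcal{G}$ has an $n$-colouring with defect $d$ (respectively, clustering $c$). The (proper) chromatic number $\chi(\mathcal{G})$ is the maximum of the chromatic numbers $\chi(G)$ over $G\in\mathcal{G}$. Let $k\geq 1$ be an integer, and let $\mathcal{G}$ be the class of triangle-free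 graphs with treewidth at most $k$. Then $$\chi_{\Delta}(\mathcal{G}) = \chi_{\star}(\mathcal{G}) = \chi(\mathcal{G}) = \left\lceil \frac{k+3}{2} \right\rceil .$$ -/

import Mathlib

universe u

/-- A finite simple undirected graph. -/
structure FiniteGraph : Type (u + 1) where
  /-- the vertex set -/
  Vertex : Type u
  finite : Finite Vertex
  graph : SimpleGraph Vertex

/-- A tree-decomposition of `G`: a family of bags indexed by the nodes of a finite tree, such that
the two ends of each edge lie in a common bag, and for each vertex the nodes whose bags contain it
induce a non-empty connected subtree (`SimpleGraph.Connected` includes non-emptiness). -/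
structure TreeDecomposition {V : Type u} (G : SimpleGraph V) where
  Node : Type
  finite : Finite Node
  tree : SimpleGraph Node
  isTree : tree.IsTree
  bag : Node → Set V
  exists_bag_of_adj : ∀ v w : V, G.Adj v w → ∃ x, v ∈ bag x ∧ w ∈ bag x
  connected_nodes : ∀ v : V, (tree.induce {x | v ∈ bag x}).Connected

/-- The width of a tree-decomposition of a finite graph: the maximum size of a bag, minus one.
It is an integer, since the graph without vertices has a tree-decomposition of width `-1`. -/
noncomputable def TreeDecomposition.width {V : Type u} {G : SimpleGraph V}
    (D : TreeDecomposition G) : ℤ :=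
  ((⨆ x, (D.bag x).ncard : ℕ) : ℤ) - 1

/-- The treewidth of a finite graph: the minimum width of a tree-decomposition. -/
noncomputable def treewidth {V : Type u} (G : SimpleGraph V) : ℤ :=
  sInf (Set.range fun D : TreeDecomposition G => D.width)

/-- The subgraph of `G` induced by the vertices of colour `i`. Its connected components, for all
`i`, are the monochromatic components of the colouring `f`. -/
abbrev colourClass {V : Type u} (G : SimpleGraph V) {n : ℕ} (f : V → Fin n) (i : Fin n) :
    SimpleGraph {v | f v = i} :=
  G.induce {v | f v = i}

/-- The colouring `f` of a finite graph has defect `d`: in each monochromatic component, every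
vertex has degree at most `d`. -/
def HasDefect {V : Type u} (G : SimpleGraph V) {n : ℕ} (f : V → Fin n) (d : ℕ) : Prop :=
  ∀ (i : Fin n) (C : (colourClass G f i).ConnectedComponent) (v : C),
    (C.toSimpleGraph.neighborSet v).ncard ≤ d

/-- The colouring `f` of a finite graph has clustering `c`: each monochromatic component has at
most `c` vertices. -/
def HasClustering {V : Type u} (G : SimpleGraph V) {n : ℕ} (f : V → Fin n) (c : ℕ) : Prop :=
  ∀ (i : Fin n) (C : (colourClass G f i).ConnectedComponent), C.supp.ncard ≤ c

/-- The defective chromatic number of a graph class: the minimum `n` such that for some `d`, every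
graph in the class has an `n`-colouring with defect `d`; it is `⊤` (unbounded) if there is no
such `n`. -/
noncomputable def defectiveChromaticNumber (𝒢 : Set FiniteGraph.{u}) : ℕ∞ :=
  sInf {m : ℕ∞ | ∃ n : ℕ, m = n ∧ ∃ d : ℕ, ∀ G ∈ 𝒢, ∃ f : G.Vertex → Fin n, HasDefect G.graph f d}

/-- The clustered chromatic number of a graph class: the minimum `n` such that for some `c`, every
graph in the class has an `n`-colouring with clustering `c`; it is `⊤` (unbounded) if there is no
such `n`. -/
noncomputable def clusteredChromaticNumber (𝒢 : Set FiniteGraph.{u}) : ℕ∞ :=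
  sInf {m : ℕ∞ | ∃ n : ℕ, m = n ∧
    ∃ c : ℕ, ∀ G ∈ 𝒢, ∃ f : G.Vertex → Fin n, HasClustering G.graph f c}

/-- The (proper) chromatic number of a graph class: the maximum chromatic number of a graph in the
class; it is `⊤` (unbounded) if there is no maximum. -/
noncomputable def classChromaticNumber (𝒢 : Set FiniteGraph.{u}) : ℕ∞ :=
  ⨆ G ∈ 𝒢, G.graph.chromaticNumber

/-- The class of triangle-free finite graphs with treewidth at most `k`. -/
def triangleFreeTreewidthAtMost (k : ℕ) : Set FiniteGraph.{u} :=
  {G | G.graph.CliqueFree 3 ∧ treewidth G.graph ≤ k}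

/-! Upper bound. Complete the bags to cliques and colour the vertices one by one, in reverse of an
elimination order of this chordal graph `F`. The invariant is that no `G`-independent set inside a
clique of `F` sees all `n` colours. A new vertex has at most `k` earlier `F`-neighbours `B`, and its
`G`-neighbours `N` among them are independent because `G` is triangle-free. If every colour outside
`f(N)` broke the invariant, `card_add_card_le_of_forall_exists_isIndepSet` would give `2n ≤ |B| + 2
≤ k + 2`.

Lower bound, for `2n ≤ k + 2`. Graphs are grown by repeatedly hanging many twin vertices on
independent subsets of bags. In a colouring of defect `d`, some twin avoids all colours of its
neighbourhood. This forces rainbow pairs `(I, J)` of ever larger potential `|I|(n + 1) + |J|` into a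
bag (`IsRainbowPair.exists_lt`), but the potential is at most `n(n + 1) + n`. Proper colourings have
defect 0 and clustering 1, and clustering `c` implies defect `c`, so the two bounds settle all three
numbers. -/

namespace SimpleGraph

/-! ### Colouring along an elimination order -/

/-- If no independent subset of `H` meets every colour of the palette `P`, but for each `c ∈ U`
some independent subset of `H` meets every colour of `P` except possibly `c`, then `H` is large. -/
theorem card_add_card_le_of_forall_exists_isIndepSet {V C : Type*} [DecidableEq V] [DecidableEq C]
    (G : SimpleGraph V) (f : V → C) (P : Finset C) :
    ∀ (H : Finset V) (U : Finset C), U ⊆ P → U.Nonempty →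
      (∀ I ⊆ H, G.IsIndepSet (I : Set V) → ¬ P ⊆ I.image f) →
      (∀ c ∈ U, ∃ I ⊆ H, G.IsIndepSet (I : Set V) ∧ P.erase c ⊆ I.image f) →
      P.card + U.card ≤ H.card + 2 := by
  classical
  induction P using Finset.strongInduction with
  | H P ih =>
  intro H U hUP hU hno hex
  obtain ⟨c, hc⟩ := hU
  by_cases h1 : U.card = 1
  · obtain ⟨I, hIH, -, hI⟩ := hex c hc
    have h2 := (Finset.card_le_card hI).trans (Finset.card_image_le.trans (Finset.card_le_card hIH))
    rw [Finset.card_erase_of_mem (hUP hc)] at h2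
    omega
  have hU2 : 1 < U.card := by
    have := Finset.card_pos.2 ⟨c, hc⟩
    omega
  -- If every colour of `P` occurs twice in `H`, then `|H| ≥ 2|P| ≥ |P| + |U|`. Otherwise a colour
  -- `e` occurring at most once is eliminated.
  by_cases hall : ∀ c ∈ P, 2 ≤ (H.filter (fun v => f v = c)).card
  · have h3 : P.card * 2 ≤ ∑ c ∈ P, (H.filter (fun v => f v = c)).card := by
      simpa using Finset.sum_le_sum hall
    have h4 : ∑ c ∈ P, (H.filter (fun v => f v = c)).card ≤ H.card := by
      rw [← Finset.card_biUnion]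
      · apply Finset.card_le_card
        intro v hv
        simp only [Finset.mem_biUnion, Finset.mem_filter] at hv
        obtain ⟨_, _, h, _⟩ := hv
        exact h
      · intro a _ b _ hab
        rw [Function.onFun, Finset.disjoint_left]
        intro v hv hv'
        exact hab ((Finset.mem_filter.1 hv).2.symm.trans (Finset.mem_filter.1 hv').2)
    have := Finset.card_le_card hUP
    omega
  push Not at hall
  obtain ⟨e, heP, he⟩ := hall
  obtain ⟨d, hd, hde⟩ := Finset.exists_mem_ne hU2 e
  have key : ∀ d ∈ U, d ≠ e → ∀ I : Finset V, P.erase d ⊆ I.image f → ∃ y ∈ I, f y = e := by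
    intro d _ hde I hI
    simpa using hI (Finset.mem_erase.2 ⟨hde.symm, heP⟩)
  obtain ⟨I, hIH, -, hI⟩ := hex d hd
  obtain ⟨y, hyI, hye⟩ := key d hd hde I hI
  have hyH := hIH hyI
  have huniq : ∀ z ∈ H, f z = e → z = y := by
    intro z hz hze
    exact Finset.card_le_one.1 (by omega : (H.filter (fun v => f v = e)).card ≤ 1) z
      (by simp [hz, hze]) y (by simp [hyH, hye])
  -- Since `y` is the only vertex of colour `e`, removing it with its neighbours and dropping `e`
  -- from the palette preserves both hypotheses: `y` can be added to, or removed from, the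
  -- independent sets in question.
  set H' := H.filter (fun v => v ≠ y ∧ ¬ G.Adj y v) with hH'
  have hins : ∀ I : Finset V, G.IsIndepSet (I : Set V) → (∀ v ∈ I, ¬ G.Adj y v) →
      G.IsIndepSet ((insert y I : Finset V) : Set V) := by
    intro I hI hy
    rw [Finset.coe_insert]
    refine Set.Pairwise.insert hI fun v hv _ => ⟨hy v hv, fun h => hy v hv h.symm⟩
  have hcov : ∀ I : Finset V, P.erase e ⊆ I.image f → P ⊆ (insert y I).image f := by
    intro I hI a ha
    by_cases hae : a = e
    · simp [hae, ← hye]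
    · rw [Finset.image_insert]
      exact Finset.mem_insert_of_mem (hI (Finset.mem_erase.2 ⟨hae, ha⟩))
  have hlt : H' ⊂ H := by
    refine Finset.ssubset_iff_subset_ne.2 ⟨Finset.filter_subset _ _, fun h => ?_⟩
    rw [← h] at hyH
    simp [hH'] at hyH
  have hbound := ih (P.erase e) (Finset.erase_ssubset heP) H' (U.erase e)
    (Finset.erase_subset_erase _ hUP) ⟨d, Finset.mem_erase.2 ⟨hde, hd⟩⟩ ?_ ?_
  · rw [Finset.card_erase_of_mem heP] at hbound
    have hP := Finset.card_pos.2 ⟨e, heP⟩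
    have hcard := Finset.card_lt_card hlt
    by_cases heU : e ∈ U
    · rw [Finset.card_erase_of_mem heU] at hbound
      obtain ⟨I, hIH, hIind, hI⟩ := hex e heU
      -- When `e ∈ U` the left side drops by 2, so a second lost vertex is needed. A set missing
      -- only `e` must contain a neighbour of `y`, as adding `y` would otherwise complete it.
      have : ∃ p ∈ I, G.Adj y p := by
        by_contra hcon
        push Not at hcon
        exact hno (insert y I) (Finset.insert_subset hyH hIH) (hins I hIind hcon) (hcov I hI)
      obtain ⟨p, hpI, hyp⟩ := this
      have hsub : H' ⊆ (H.erase y).erase p := by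
        intro v hv
        simp only [hH', Finset.mem_filter] at hv
        simp only [Finset.mem_erase]
        refine ⟨?_, hv.2.1, hv.1⟩
        rintro rfl
        exact hv.2.2 hyp
      have h5 := Finset.card_le_card hsub
      rw [Finset.card_erase_of_mem (Finset.mem_erase.2 ⟨hyp.ne', hIH hpI⟩),
        Finset.card_erase_of_mem hyH] at h5
      have h6 : 1 < H.card := Finset.one_lt_card.2 ⟨y, hyH, p, hIH hpI, hyp.ne⟩
      omega
    · rw [Finset.erase_eq_of_notMem heU] at hbound
      omega
  · intro I hI hIind hPI
    refine hno (insert y I) (Finset.insert_subset hyH (hI.trans hlt.subset)) (hins I hIind ?_)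
      (hcov I hPI)
    intro v hv
    exact (Finset.mem_filter.1 (hI hv)).2.2
  · intro c hc
    obtain ⟨hce, hcU⟩ := Finset.mem_erase.1 hc
    obtain ⟨I, hIH, hIind, hI⟩ := hex c hcU
    obtain ⟨z, hzI, hze⟩ := key c hcU hce I hI
    obtain rfl := huniq z (hIH hzI) hze
    refine ⟨I.erase z, ?_, hIind.mono (by simp), ?_⟩
    · intro v hv
      obtain ⟨hvz, hvI⟩ := Finset.mem_erase.1 hv
      exact Finset.mem_filter.2 ⟨hIH hvI, hvz, hIind hzI hvI hvz.symm⟩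
    · intro a ha
      obtain ⟨hac, hae, haP⟩ : a ≠ c ∧ a ≠ e ∧ a ∈ P := by simpa using ha
      obtain ⟨v, hv, rfl⟩ := Finset.mem_image.1 (hI (Finset.mem_erase.2 ⟨hac, haP⟩))
      refine Finset.mem_image_of_mem _ (Finset.mem_erase.2 ⟨?_, hv⟩)
      rintro rfl
      exact hae hze

/-- A new vertex with independent neighbourhood `N ⊆ B` can be given a colour so that it is
properly coloured and still no independent set meets every colour. -/
theorem exists_colour_of_card_add_three_le {V : Type*} [DecidableEq V] (G : SimpleGraph V) {n : ℕ}
    (f : V → Fin n) (B N : Finset V) (hB : B.card + 3 ≤ 2 * n) (hNB : N ⊆ B)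
    (hN : G.IsIndepSet (N : Set V))
    (hno : ∀ I ⊆ B, G.IsIndepSet (I : Set V) → ¬ Finset.univ ⊆ I.image f) :
    ∃ c ∉ N.image f, ∀ I ⊆ B \ N, G.IsIndepSet (I : Set V) →
      ¬ Finset.univ.erase c ⊆ I.image f := by
  by_contra hcon
  push Not at hcon
  -- `N` is itself independent, so by `hno` it misses a colour.
  have hU : ((N.image f)ᶜ).Nonempty := by
    rw [Finset.nonempty_iff_ne_empty, Ne, Finset.compl_eq_empty_iff]
    intro h
    exact hno N hNB hN h.ge
  have h := card_add_card_le_of_forall_exists_isIndepSet G f Finset.univ (B \ N) (N.image f)ᶜ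
    (Finset.subset_univ _) hU (fun I hI => hno I (hI.trans Finset.sdiff_subset))
    (fun c hc => hcon c (Finset.mem_compl.1 hc))
  -- This reads `n + (n - |f(N)|) ≤ |B| - |N| + 2`, where `|f(N)| ≤ |N|`.
  rw [Finset.card_compl, Finset.card_univ, Fintype.card_fin, Finset.card_sdiff_of_subset hNB] at h
  have h1 : (N.image f).card ≤ N.card := Finset.card_image_le
  have h2 := Finset.card_le_card hNB
  omega

/-- A triangle-free graph with a chordal supergraph `F` (given by its elimination property) of
clique number at most `k + 1` is `n`-colourable if `k + 3 ≤ 2 * n`. -/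
theorem colorable_of_elimination {V : Type*} [Finite V] (G F : SimpleGraph V) (hGF : G ≤ F)
    (hG : G.CliqueFree 3) {k n : ℕ} (hkn : k + 3 ≤ 2 * n)
    (helim : ∀ S : Finset V, S.Nonempty → ∃ v ∈ S, F.IsClique {u | u ∈ S ∧ F.Adj v u} ∧
      {u | u ∈ S ∧ F.Adj v u}.ncard ≤ k) : G.Colorable n := by
  classical
  have := Fintype.ofFinite V
  suffices h : ∀ S : Finset V, ∃ f : V → Fin n, (∀ v ∈ S, ∀ w ∈ S, G.Adj v w → f v ≠ f w) ∧
      ∀ I ⊆ S, F.IsClique (I : Set V) → G.IsIndepSet (I : Set V) →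
        ¬ Finset.univ ⊆ I.image f by
    obtain ⟨f, hf, -⟩ := h Finset.univ
    exact ⟨Coloring.mk f fun {v w} hvw => hf v (Finset.mem_univ _) w (Finset.mem_univ _) hvw⟩
  intro S
  induction S using Finset.strongInduction with
  | H S ih =>
  obtain rfl | hS := S.eq_empty_or_nonempty
  · refine ⟨fun _ => ⟨0, by omega⟩, by simp, fun I hI _ _ h => ?_⟩
    obtain rfl := Finset.subset_empty.1 hI
    have := h (Finset.mem_univ (⟨0, by omega⟩ : Fin n))
    simp at this
  obtain ⟨v, hv, hclique, hcard⟩ := helim S hS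
  obtain ⟨f, hf, hno⟩ := ih (S.erase v) (Finset.erase_ssubset hv)
  set B := S.filter (fun u => F.Adj v u) with hB
  have hBcoe : (B : Set V) = {u | u ∈ S ∧ F.Adj v u} := by simp [hB]
  rw [← hBcoe] at hclique hcard
  rw [Set.ncard_coe_finset] at hcard
  have hBS : B ⊆ S.erase v := by
    intro u hu
    obtain ⟨hu1, hu2⟩ := Finset.mem_filter.1 hu
    exact Finset.mem_erase.2 ⟨hu2.ne', hu1⟩
  set N := S.filter (fun u => G.Adj v u) with hN
  have hNB : N ⊆ B := fun u hu => by
    obtain ⟨hu1, hu2⟩ := Finset.mem_filter.1 hu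
    exact Finset.mem_filter.2 ⟨hu1, hGF hu2⟩
  have hNind : G.IsIndepSet (N : Set V) := by
    intro a ha b hb _ hab
    exact hG {v, a, b} (is3Clique_triple_iff.2
      ⟨(Finset.mem_filter.1 ha).2, (Finset.mem_filter.1 hb).2, hab⟩)
  obtain ⟨c, hcN, hc⟩ := exists_colour_of_card_add_three_le G f B N (by omega) hNB hNind
    fun I hI hIind => hno I (hI.trans hBS) (hclique.subset (by exact_mod_cast hI)) hIind
  have hcadj : ∀ w ∈ S, G.Adj v w → f w ≠ c := by
    intro w hw hvw h
    exact hcN (Finset.mem_image.2 ⟨w, Finset.mem_filter.2 ⟨hw, hvw⟩, h⟩)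
  refine ⟨Function.update f v c, ?_, ?_⟩
  · intro a ha b hb hab
    by_cases hav : a = v
    · subst hav
      rw [Function.update_self, Function.update_of_ne hab.ne']
      exact (hcadj b hb hab).symm
    by_cases hbv : b = v
    · subst hbv
      rw [Function.update_self, Function.update_of_ne hab.ne]
      exact hcadj a ha hab.symm
    rw [Function.update_of_ne hav, Function.update_of_ne hbv]
    exact hf a (Finset.mem_erase.2 ⟨hav, ha⟩) b (Finset.mem_erase.2 ⟨hbv, hb⟩) hab
  · intro I hIS hIF hIG hfull
    have hupd : ∀ a, (∃ w ∈ I, Function.update f v c w = a) → (v ∉ I ∨ a ≠ c) →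
        a ∈ (I.erase v).image f := by
      rintro a ⟨w, hw, rfl⟩ h
      have hwv : w ≠ v := by
        rintro rfl
        simp [hw] at h
      exact Finset.mem_image.2 ⟨w, Finset.mem_erase.2 ⟨hwv, hw⟩, by simp [hwv]⟩
    -- If `v ∈ I`, the rest of `I` lies in `B \ N` and must show every colour but `c`, against the
    -- choice of `c`. If not, the invariant for `S.erase v` applies.
    by_cases hvI : v ∈ I
    · refine hc (I.erase v) ?_ (hIG.mono (by simp)) ?_
      · intro u hu
        obtain ⟨huv, huI⟩ := Finset.mem_erase.1 hu
        exact Finset.mem_sdiff.2 ⟨Finset.mem_filter.2 ⟨hIS huI, hIF hvI huI huv.symm⟩,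
          fun h => hIG hvI huI huv.symm (Finset.mem_filter.1 h).2⟩
      · intro a ha
        exact hupd a (Finset.mem_image.1 (hfull (Finset.mem_univ a)))
          (.inr (Finset.ne_of_mem_erase ha))
    · refine hno (I.erase v) (Finset.erase_subset_erase _ hIS) (hIF.subset (by simp))
        (hIG.mono (by simp)) ?_
      intro a _
      exact hupd a (Finset.mem_image.1 (hfull (Finset.mem_univ a))) (.inl hvI)

/-! ### Rooted subtrees and the chordal completion -/

/-- In a tree rooted at `r`, the path from `r` to a vertex `x` of a connected set `X` passes
through the vertex `a` of `X` closest to `r`, and stays in `X` from there on. -/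
theorem exists_isPath_through_closest {N : Type*} {T : SimpleGraph N} (hT : T.Connected) (r : N)
    {X : Set N} (hX : (T.induce X).Connected) {a x : N} (ha : a ∈ X)
    (hmin : ∀ y ∈ X, T.dist r a ≤ T.dist r y) (hx : x ∈ X) :
    ∃ (q : T.Walk r a) (p : T.Walk a x), (q.append p).IsPath ∧
      (∀ y ∈ q.support, T.dist r a ≤ T.dist r y → y = a) ∧ ∀ y ∈ p.support, y ∈ X := by
  classical
  obtain ⟨q, hq, hqlen⟩ := hT.exists_path_of_dist r a
  obtain ⟨p₀, hp₀⟩ := (hX.preconnected ⟨a, ha⟩ ⟨x, hx⟩).exists_isPath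
  let p : T.Walk a x := p₀.map (Embedding.induce X).toHom
  have hp : p.IsPath := hp₀.map Subtype.val_injective
  have hq' : ∀ y ∈ q.support, T.dist r a ≤ T.dist r y → y = a := by
    intro y hy hle
    have h1 : (q.takeUntil y hy).length + (q.dropUntil y hy).length = q.length := by
      rw [← Walk.length_append, Walk.take_spec]
    have h2 := dist_le (q.takeUntil y hy)
    exact Walk.eq_of_length_eq_zero (p := q.dropUntil y hy) (by omega)
  have hpX : ∀ y ∈ p.support, y ∈ X := by
    intro y hy
    obtain ⟨z, -, rfl⟩ := List.mem_map.1 (Walk.support_map _ p₀ ▸ hy)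
    exact z.2
  refine ⟨q, p, ?_, hq', hpX⟩
  -- Apart from `a`, the geodesic `q` is strictly closer to `r` than any vertex of `X`, so it meets
  -- `p` only in `a`.
  rw [Walk.isPath_def, Walk.support_append, List.nodup_append']
  have hnd := hp.support_nodup
  rw [← Walk.cons_tail_support] at hnd
  refine ⟨hq.support_nodup, hnd.of_cons, fun y hy hy' => ?_⟩
  have hya := hq' y hy (hmin y (hpX y (List.mem_of_mem_tail hy')))
  rw [hya] at hy'
  exact (List.nodup_cons.1 hnd).1 hy'

/-- Given two subtrees that meet, the root of the deeper one lies in the other one. -/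
theorem IsTree.closest_mem_of_inter {N : Type*} {T : SimpleGraph N} (hT : T.IsTree) (r : N)
    {X Y : Set N} (hX : (T.induce X).Connected) (hY : (T.induce Y).Connected) {a b x : N}
    (ha : a ∈ X) (hamin : ∀ y ∈ X, T.dist r a ≤ T.dist r y)
    (hb : b ∈ Y) (hbmin : ∀ y ∈ Y, T.dist r b ≤ T.dist r y)
    (hab : T.dist r a ≤ T.dist r b) (hxX : x ∈ X) (hxY : x ∈ Y) : b ∈ X := by
  obtain ⟨q, p, hqp, hq, hp⟩ := exists_isPath_through_closest hT.connected r hX ha hamin hxX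
  obtain ⟨q', p', hqp', -, -⟩ := exists_isPath_through_closest hT.connected r hY hb hbmin hxY
  -- Paths in a tree are unique, so `b` lies on the path through `a`: either on `p`, inside `X`, or
  -- on `q`, where its depth forces `b = a`.
  have heq : q'.append p' = q.append p :=
    congrArg Subtype.val ((hT.isAcyclic.subsingleton_path r x).elim ⟨_, hqp'⟩ ⟨_, hqp⟩)
  have hmem : b ∈ (q'.append p').support := by
    rw [Walk.mem_support_append_iff]
    exact .inl q'.end_mem_support
  rw [heq, Walk.mem_support_append_iff] at hmem
  rcases hmem with h | h
  · rw [hq b h hab]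
    exact ha
  · exact hp b h

end SimpleGraph

namespace TreeDecomposition

/-- The chordal completion of a tree-decomposition: two vertices are adjacent if they share a
bag. -/
def completion {V : Type u} {G : SimpleGraph V} (D : TreeDecomposition G) : SimpleGraph V where
  Adj v w := v ≠ w ∧ ∃ x, v ∈ D.bag x ∧ w ∈ D.bag x
  symm := ⟨fun _ _ ⟨h, x, hv, hw⟩ => ⟨h.symm, x, hw, hv⟩⟩
  loopless := ⟨fun _ h => h.1 rfl⟩

theorem le_completion {V : Type u} {G : SimpleGraph V} (D : TreeDecomposition G) :
    G ≤ D.completion :=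
  fun v w h => ⟨h.ne, D.exists_bag_of_adj v w h⟩

/-- Take `v` in `S` whose node closest to the root is as deep as possible. Every subtree of another
vertex of `S` that meets the subtree of `v` then contains that node, so one bag holds `v` and all
its neighbours in `S`. -/
theorem completion_elimination {V : Type u} [Finite V] {G : SimpleGraph V}
    (D : TreeDecomposition G) {k : ℕ} (hk : ∀ x, (D.bag x).ncard ≤ k + 1) (S : Finset V)
    (hS : S.Nonempty) :
    ∃ v ∈ S, D.completion.IsClique {u | u ∈ S ∧ D.completion.Adj v u} ∧
      {u | u ∈ S ∧ D.completion.Adj v u}.ncard ≤ k := by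
  have := D.finite
  obtain ⟨r⟩ := D.isTree.connected.nonempty
  have htop : ∀ v, ∃ t, v ∈ D.bag t ∧ ∀ y, v ∈ D.bag y → D.tree.dist r t ≤ D.tree.dist r y := by
    intro v
    obtain ⟨⟨x, hx⟩⟩ := (D.connected_nodes v).nonempty
    exact Set.exists_min_image {x | v ∈ D.bag x} (D.tree.dist r) (Set.toFinite _) ⟨x, hx⟩
  choose t ht htmin using htop
  obtain ⟨v, hv, hmax⟩ := S.exists_max_image (fun v => D.tree.dist r (t v)) hS
  have hsub : ∀ u, u ∈ S → D.completion.Adj v u → u ∈ D.bag (t v) := by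
    rintro u hu ⟨-, x, hvx, hux⟩
    exact D.isTree.closest_mem_of_inter r (D.connected_nodes u) (D.connected_nodes v) (ht u)
      (htmin u) (ht v) (htmin v) (hmax u hu) hux hvx
  refine ⟨v, hv, ?_, ?_⟩
  · intro a ha b hb hab
    exact ⟨hab, t v, hsub a ha.1 ha.2, hsub b hb.1 hb.2⟩
  · have h1 : insert v {u | u ∈ S ∧ D.completion.Adj v u} ⊆ D.bag (t v) := by
      rintro u (rfl | hu)
      · exact ht u
      · exact hsub u hu.1 hu.2
    have h2 := (Set.ncard_le_ncard h1 (Set.toFinite _)).trans (hk (t v))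
    rw [Set.ncard_insert_of_notMem (by simp)] at h2
    omega

end TreeDecomposition

/-- The one-bag tree-decomposition. -/
def TreeDecomposition.trivial {V : Type u} (G : SimpleGraph V) : TreeDecomposition G where
  Node := Unit
  finite := inferInstance
  tree := ⊥
  isTree := SimpleGraph.IsTree.of_subsingleton
  bag _ := Set.univ
  exists_bag_of_adj _ _ _ := ⟨(), Set.mem_univ _, Set.mem_univ _⟩
  connected_nodes v := by
    have : Nonempty {x : Unit | v ∈ (Set.univ : Set V)} := ⟨⟨(), Set.mem_univ v⟩⟩
    exact SimpleGraph.Connected.of_subsingleton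

theorem TreeDecomposition.width_le_iff {V : Type u} {G : SimpleGraph V} (D : TreeDecomposition G)
    {k : ℕ} : D.width ≤ k ↔ ∀ x, (D.bag x).ncard ≤ k + 1 := by
  have := D.finite
  obtain ⟨r⟩ := D.isTree.connected.nonempty
  have : Nonempty D.Node := ⟨r⟩
  rw [TreeDecomposition.width, sub_le_iff_le_add]
  norm_cast
  exact ciSup_le_iff (Set.finite_range _).bddAbove

theorem treewidth_le_iff {V : Type u} {G : SimpleGraph V} {k : ℕ} :
    treewidth G ≤ k ↔ ∃ D : TreeDecomposition G, ∀ x, (D.bag x).ncard ≤ k + 1 := by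
  -- A set of integers that is non-empty and bounded below attains its infimum.
  have hbdd : BddBelow (Set.range fun D : TreeDecomposition G => D.width) := by
    refine ⟨-1, ?_⟩
    rintro _ ⟨D, rfl⟩
    exact le_sub_iff_add_le.2 (by simp)
  constructor
  · intro h
    obtain ⟨D, hD⟩ := Int.csInf_mem (Set.range_nonempty_iff_nonempty.2 ⟨.trivial G⟩) hbdd
    refine ⟨D, D.width_le_iff.1 ?_⟩
    exact hD.trans_le h
  · rintro ⟨D, hD⟩
    exact (csInf_le hbdd ⟨D, rfl⟩).trans (D.width_le_iff.2 hD)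

theorem colorable_of_treewidth_le {V : Type u} [Finite V] {G : SimpleGraph V}
    (hG : G.CliqueFree 3) {k n : ℕ} (hkn : k + 3 ≤ 2 * n) (hk : treewidth G ≤ k) :
    G.Colorable n := by
  obtain ⟨D, hD⟩ := treewidth_le_iff.1 hk
  exact G.colorable_of_elimination D.completion D.le_completion hG hkn
    (D.completion_elimination hD)

/-! ### Attaching new vertices -/

namespace SimpleGraph

/-- The graph obtained from `G` by adding, for each `i : ι`, a new vertex with neighbourhood
`s i`. -/
def attach {V ι : Type*} (G : SimpleGraph V) (s : ι → Set V) : SimpleGraph (V ⊕ ι) where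
  Adj
    | .inl v, .inl w => G.Adj v w
    | .inl v, .inr i => v ∈ s i
    | .inr i, .inl v => v ∈ s i
    | .inr _, .inr _ => False
  symm := ⟨by rintro (v | i) (w | j) h <;> first | exact h | exact SimpleGraph.Adj.symm (G := G) h⟩
  loopless := ⟨by rintro (v | i) h <;> first | exact G.loopless.irrefl v h | exact h⟩

section attach

variable {V ι : Type*} {G : SimpleGraph V} {s : ι → Set V}

@[simp] theorem attach_adj_inl_inl {v w : V} : (G.attach s).Adj (.inl v) (.inl w) ↔ G.Adj v w :=
  Iff.rfl

@[simp] theorem attach_adj_inl_inr {v : V} {i : ι} : (G.attach s).Adj (.inl v) (.inr i) ↔ v ∈ s i :=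
  Iff.rfl

@[simp] theorem attach_adj_inr_inl {v : V} {i : ι} : (G.attach s).Adj (.inr i) (.inl v) ↔ v ∈ s i :=
  Iff.rfl

@[simp] theorem attach_adj_inr_inr {i j : ι} : ¬ (G.attach s).Adj (.inr i) (.inr j) :=
  id

/-- The embedding of `G` into `G.attach s`. -/
def attachEmbedding (G : SimpleGraph V) (s : ι → Set V) : G ↪g G.attach s where
  toFun := Sum.inl
  inj' := Sum.inl_injective
  map_rel_iff' := Iff.rfl

/-- New vertices are pairwise non-adjacent, so a triangle would use at most one of them, together
with an edge inside its independent neighbourhood. -/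
theorem attach_cliqueFree_three (hG : G.CliqueFree 3) (hs : ∀ i, G.IsIndepSet (s i)) :
    (G.attach s).CliqueFree 3 := by
  classical
  have hind : ∀ i v w, v ∈ s i → w ∈ s i → ¬ G.Adj v w := fun i v w hv hw h =>
    hs i hv hw h.ne h
  intro t ht
  obtain ⟨a, b, c, hab, hac, hbc, -⟩ := is3Clique_iff.1 ht
  rcases a with a | a <;> rcases b with b | b <;> rcases c with c | c <;>
    simp only [attach_adj_inl_inl, attach_adj_inl_inr, attach_adj_inr_inl,
      attach_adj_inr_inr] at hab hac hbc
  · exact hG {a, b, c} (is3Clique_triple_iff.2 ⟨hab, hac, hbc⟩)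
  · exact hind _ _ _ hac hbc hab
  · exact hind _ _ _ hab hbc hac
  · exact hind _ _ _ hab hac hbc

/-- Attaching leaves to a tree gives a tree. -/
theorem IsTree.attach_leaves {N : Type*} {T : SimpleGraph N} (hT : T.IsTree) (p : ι → N) :
    (T.attach fun i => {p i}).IsTree := by
  refine ⟨?_, ?_⟩
  · rw [connected_iff_exists_forall_reachable]
    obtain ⟨r⟩ := hT.connected.nonempty
    have h1 : ∀ x, (T.attach fun i => {p i}).Reachable (.inl r) (.inl x) := fun x =>
      (hT.connected.preconnected r x).map (T.attachEmbedding _).toHom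
    refine ⟨.inl r, ?_⟩
    rintro (x | i)
    · exact h1 x
    · exact (h1 (p i)).trans (Adj.reachable (by simp))
  · rw [isAcyclic_iff_forall_adj_isBridge]
    -- Retracting each leaf `i` onto `p i` turns a walk avoiding the edge `ab` into one of `T`
    -- avoiding it.
    have key : ∀ a b, T.Adj a b → ∀ x y,
        (T.attach fun i => {p i}).Adj x y → s(x, y) ≠ s(.inl a, .inl b) →
        (T.deleteEdges {s(a, b)}).Reachable (Sum.elim id p x) (Sum.elim id p y) := by
      rintro a b - (x | i) (y | j) hxy hne
      · refine Adj.reachable ?_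
        rw [deleteEdges_adj]
        refine ⟨hxy, fun h => hne ?_⟩
        simpa using h
      · obtain rfl : x = p j := hxy
        exact Reachable.refl _
      · obtain rfl : y = p i := hxy
        exact Reachable.refl _
      · exact (attach_adj_inr_inr hxy).elim
    have hleaf : ∀ i, (T.attach fun i => {p i}).IsBridge s(.inr i, .inl (p i)) := by
      intro i
      rw [isBridge_iff]
      rintro ⟨w⟩
      cases w with
      | cons h w =>
        rename_i z
        obtain ⟨h1, h2⟩ := (deleteEdges_adj).1 h
        rcases z with z | z
        · obtain rfl : z = p i := h1
          exact h2 rfl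
        · exact attach_adj_inr_inr h1
    rintro (a | i) (b | j) hab
    · have hab' : T.Adj a b := hab
      have hbr := isAcyclic_iff_forall_adj_isBridge.1 hT.isAcyclic hab'
      rw [isBridge_iff] at hbr ⊢
      rintro ⟨w⟩
      have hw : ∀ {x y} (w : ((T.attach fun i => {p i}).deleteEdges {s(.inl a, .inl b)}).Walk x y),
          (T.deleteEdges {s(a, b)}).Reachable (Sum.elim id p x) (Sum.elim id p y) := by
        intro x y w
        induction w with
        | nil => exact Reachable.refl _
        | cons h w ih =>
          obtain ⟨h1, h2⟩ := (deleteEdges_adj).1 h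
          exact (key a b hab' _ _ h1 h2).trans ih
      exact hbr (hw w)
    · obtain rfl : a = p j := hab
      rw [Sym2.eq_swap]
      exact hleaf j
    · obtain rfl : b = p i := hab
      exact hleaf i
    · exact (attach_adj_inr_inr hab).elim

end attach

/-! ### Defective colourings and rainbow pairs -/

/-- Every vertex has at most `d` neighbours of its own colour. -/
def IsDefective {V C : Type*} (G : SimpleGraph V) (f : V → C) (d : ℕ) : Prop :=
  ∀ v, {u | G.Adj v u ∧ f u = f v}.ncard ≤ d

theorem IsDefective.comp_embedding {V W C : Type*} [Finite W] {G : SimpleGraph V}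
    {H : SimpleGraph W} {f : W → C} {d : ℕ} (h : H.IsDefective f d) (e : G ↪g H) :
    G.IsDefective (f ∘ e) d := by
  intro v
  rw [← Set.ncard_image_of_injective _ e.injective]
  refine (Set.ncard_le_ncard ?_ (Set.toFinite _)).trans (h (e v))
  rintro _ ⟨u, ⟨hu, hf⟩, rfl⟩
  exact ⟨e.map_adj_iff.2 hu, hf⟩

/-- Among many vertices that dominate `N`, one is coloured differently from all of `N`. -/
theorem IsDefective.exists_colour_notMem_image {V C : Type*} [Finite V] [DecidableEq C]
    {G : SimpleGraph V} {f : V → C} {d : ℕ} (h : G.IsDefective f d) (N : Finset V) {M : ℕ}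
    (hM : N.card * d < M) (w : Fin M → V) (hw : Function.Injective w)
    (hadj : ∀ i, ∀ u ∈ N, G.Adj u (w i)) : ∃ i, f (w i) ∉ N.image f := by
  classical
  by_contra hcon
  push Not at hcon
  simp only [Finset.mem_image] at hcon
  choose g hgN hg using hcon
  -- Otherwise each `w i` shares its colour with some `g i ∈ N`, and by pigeonhole one `u ∈ N` gets
  -- more than `d` neighbours of its own colour.
  obtain ⟨u, hu, hlt⟩ := Finset.exists_lt_card_fiber_of_mul_lt_card_of_maps_to
    (s := (Finset.univ : Finset (Fin M))) (t := N) (f := g) (n := d) (fun i _ => hgN i)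
    (by simpa using hM)
  refine absurd (h u) (not_le.2 (hlt.trans_le ?_))
  rw [← Finset.card_image_of_injective _ hw, ← Set.ncard_coe_finset]
  refine Set.ncard_le_ncard ?_ (Set.toFinite _)
  intro x hx
  obtain ⟨i, hi, rfl⟩ := Finset.mem_image.1 (Finset.mem_coe.1 hx)
  obtain rfl := (Finset.mem_filter.1 hi).2
  exact ⟨hadj i _ hu, (hg i).symm⟩

/-- Two disjoint independent rainbow sets such that every colour on `J` appears on `I`, and edges
between `J` and `I` only lead to vertices of `I` whose colour appears on `J`. -/
structure IsRainbowPair {V C : Type*} [DecidableEq C] (G : SimpleGraph V) (f : V → C)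
    (I J : Finset V) : Prop where
  disjoint : Disjoint I J
  indep_left : G.IsIndepSet (I : Set V)
  indep_right : G.IsIndepSet (J : Set V)
  injOn_left : Set.InjOn f I
  injOn_right : Set.InjOn f J
  image_subset : J.image f ⊆ I.image f
  mem_image_of_adj : ∀ w ∈ J, ∀ u ∈ I, G.Adj w u → f u ∈ J.image f

namespace IsRainbowPair

theorem map {V W C : Type*} [DecidableEq C] {G : SimpleGraph V} {H : SimpleGraph W} {f : W → C}
    {I J : Finset V} (e : G ↪g H) (h : G.IsRainbowPair (f ∘ e) I J) :
    H.IsRainbowPair f (I.map e.toEmbedding) (J.map e.toEmbedding) := by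
  classical
  have hindep : ∀ K : Finset V, G.IsIndepSet (K : Set V) →
      H.IsIndepSet (K.map e.toEmbedding : Set W) := by
    intro K hK
    rw [Finset.coe_map]
    rintro _ ⟨a, ha, rfl⟩ _ ⟨b, hb, rfl⟩ hab hadj
    exact hK ha hb (fun h => hab (h ▸ rfl)) (e.map_adj_iff.1 hadj)
  have hinj : ∀ K : Finset V, Set.InjOn (f ∘ e) K →
      Set.InjOn f (K.map e.toEmbedding : Set W) := by
    intro K hK
    rw [Finset.coe_map]
    rintro _ ⟨a, ha, rfl⟩ _ ⟨b, hb, rfl⟩ hab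
    exact congrArg e (hK ha hb hab)
  have himage : ∀ K : Finset V, (K.map e.toEmbedding).image f = K.image (f ∘ e) := by
    intro K
    rw [Finset.map_eq_image, Finset.image_image]
    rfl
  refine ⟨(Finset.disjoint_map _).2 h.disjoint, hindep _ h.indep_left, hindep _ h.indep_right,
    hinj _ h.injOn_left, hinj _ h.injOn_right, ?_, ?_⟩
  · rw [himage, himage]
    exact h.image_subset
  · intro w hw u hu hadj
    obtain ⟨w, hwJ, rfl⟩ := Finset.mem_map.1 hw
    obtain ⟨u, huI, rfl⟩ := Finset.mem_map.1 hu
    rw [himage]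
    exact h.mem_image_of_adj w hwJ u huI (e.map_adj_iff.1 hadj)

variable {V : Type*} {G : SimpleGraph V} {n : ℕ} {f : V → Fin n} {I J : Finset V}

theorem card_left_le (h : G.IsRainbowPair f I J) : I.card ≤ n := by
  rw [← Finset.card_image_of_injOn h.injOn_left]
  simpa using Finset.card_le_univ (I.image f)

theorem card_right_le (h : G.IsRainbowPair f I J) : J.card ≤ I.card := by
  rw [← Finset.card_image_of_injOn h.injOn_left, ← Finset.card_image_of_injOn h.injOn_right]
  exact Finset.card_le_card h.image_subset

/-- A new vertex with the right neighbourhood increases the potential of a rainbow pair. -/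
theorem exists_lt [DecidableEq V] (h : G.IsRainbowPair f I J) {v : V} (hvI : v ∉ I) (hvJ : v ∉ J)
    (hadjI : ∀ u ∈ I, (G.Adj v u ↔ f u ∈ J.image f)) (hadjJ : ∀ u ∈ J, ¬ G.Adj v u)
    (hv : f v ∉ J.image f) :
    ∃ I' J', G.IsRainbowPair f I' J' ∧ I' ⊆ insert v (I ∪ J) ∧ J' ⊆ insert v (I ∪ J) ∧
      I.card * (n + 1) + J.card < I'.card * (n + 1) + J'.card := by
  have hinsert : ∀ K : Finset V, G.IsIndepSet (K : Set V) → (∀ u ∈ K, ¬ G.Adj v u) →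
      G.IsIndepSet ((insert v K : Finset V) : Set V) := by
    intro K hK hvK
    rw [Finset.coe_insert]
    exact Set.Pairwise.insert hK fun u hu _ => ⟨hvK u hu, fun h => hvK u hu h.symm⟩
  have hinj : ∀ K : Finset V, Set.InjOn f K → f v ∉ K.image f →
      Set.InjOn f ((insert v K : Finset V) : Set V) := by
    intro K hK hvK
    rw [Finset.coe_insert, Set.injOn_insert (fun h => hvK (Finset.mem_image_of_mem f h))]
    exact ⟨hK, by simpa using hvK⟩
  by_cases hvc : f v ∈ I.image f
  · refine ⟨I, insert v J, ⟨?_, h.indep_left, hinsert J h.indep_right hadjJ, h.injOn_left,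
      hinj J h.injOn_right hv, ?_, ?_⟩, ?_, ?_, ?_⟩
    · rw [Finset.disjoint_insert_right]
      exact ⟨hvI, h.disjoint⟩
    · rw [Finset.image_insert]
      exact Finset.insert_subset hvc h.image_subset
    · intro w hw u hu hadj
      rw [Finset.image_insert]
      apply Finset.mem_insert_of_mem
      obtain rfl | hw := Finset.mem_insert.1 hw
      · exact (hadjI u hu).1 hadj
      · exact h.mem_image_of_adj w hw u hu hadj
    · exact Finset.subset_union_left.trans (Finset.subset_insert _ _)
    · exact Finset.insert_subset_insert _ Finset.subset_union_right
    · rw [Finset.card_insert_of_notMem hvJ]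
      omega
  -- The colour of `v` is new to `I`. Exchanging the vertices of `I` coloured as in `J` for those of
  -- `J` keeps the colours and the independence, and removes all neighbours of `v`, so `v` can be
  -- added.
  · set K := J ∪ I.filter (fun u => f u ∉ J.image f) with hK
    have hKsub : K ⊆ I ∪ J := by
      intro u hu
      rcases Finset.mem_union.1 hu with hu | hu
      · exact Finset.mem_union_right _ hu
      · exact Finset.mem_union_left _ (Finset.mem_filter.1 hu).1
    have hKind : G.IsIndepSet (K : Set V) := by
      intro a ha b hb hab hadj
      rcases Finset.mem_union.1 (Finset.mem_coe.1 ha) with ha | ha <;>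
        rcases Finset.mem_union.1 (Finset.mem_coe.1 hb) with hb | hb
      · exact h.indep_right ha hb hab hadj
      · exact (Finset.mem_filter.1 hb).2
          (h.mem_image_of_adj a ha b (Finset.mem_filter.1 hb).1 hadj)
      · exact (Finset.mem_filter.1 ha).2
          (h.mem_image_of_adj b hb a (Finset.mem_filter.1 ha).1 hadj.symm)
      · exact h.indep_left (Finset.mem_filter.1 ha).1 (Finset.mem_filter.1 hb).1 hab hadj
    have hKinj : Set.InjOn f K := by
      intro a ha b hb hab
      rcases Finset.mem_union.1 (Finset.mem_coe.1 ha) with ha | ha <;>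
        rcases Finset.mem_union.1 (Finset.mem_coe.1 hb) with hb | hb
      · exact h.injOn_right ha hb hab
      · exact ((Finset.mem_filter.1 hb).2 (hab ▸ Finset.mem_image_of_mem f ha)).elim
      · exact ((Finset.mem_filter.1 ha).2 (hab ▸ Finset.mem_image_of_mem f hb)).elim
      · exact h.injOn_left (Finset.mem_filter.1 ha).1 (Finset.mem_filter.1 hb).1 hab
    have hKimage : K.image f = I.image f := by
      ext c
      constructor
      · intro hc
        obtain ⟨u, hu, rfl⟩ := Finset.mem_image.1 hc
        rcases Finset.mem_union.1 hu with hu | hu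
        · exact h.image_subset (Finset.mem_image_of_mem f hu)
        · exact Finset.mem_image_of_mem f (Finset.mem_filter.1 hu).1
      · intro hc
        obtain ⟨u, hu, rfl⟩ := Finset.mem_image.1 hc
        rw [hK, Finset.image_union, Finset.mem_union]
        by_cases huJ : f u ∈ J.image f
        · exact .inl huJ
        · exact .inr (Finset.mem_image_of_mem f (Finset.mem_filter.2 ⟨hu, huJ⟩))
    have hKcard : K.card = I.card := by
      rw [← Finset.card_image_of_injOn hKinj, hKimage, Finset.card_image_of_injOn h.injOn_left]
    have hvK : ∀ u ∈ K, ¬ G.Adj v u := by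
      intro u hu hadj
      rcases Finset.mem_union.1 hu with hu | hu
      · exact hadjJ u hu hadj
      · exact (Finset.mem_filter.1 hu).2 ((hadjI u (Finset.mem_filter.1 hu).1).1 hadj)
    have hv' : v ∉ K := fun hm => (Finset.mem_union.1 (hKsub hm)).elim hvI hvJ
    refine ⟨insert v K, ∅, ⟨by simp, hinsert K hKind hvK, by simp [IsIndepSet],
      hinj K hKinj (hKimage ▸ hvc), by simp, by simp, by simp⟩,
      Finset.insert_subset_insert _ hKsub, by simp, ?_⟩
    rw [Finset.card_insert_of_notMem hv', hKcard, Finset.card_empty]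
    -- Emptying `J` costs at most `n`, less than the gain `n + 1` from the larger `I`.
    have := h.card_right_le.trans h.card_left_le
    nlinarith

end IsRainbowPair

end SimpleGraph

/-! ### Lower bound construction -/

/-- Attach, for each `i : ι`, a leaf to the node `p i`, whose bag consists of the part `S i` of the
bag of `p i` and a new vertex with neighbourhood `s i ⊆ S i`. -/
def TreeDecomposition.attach {V ι : Type} [Finite ι] {G : SimpleGraph V} (D : TreeDecomposition G)
    (p : ι → D.Node) (S s : ι → Set V) (hS : ∀ i, S i ⊆ D.bag (p i)) (hs : ∀ i, s i ⊆ S i) :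
    TreeDecomposition (G.attach s) where
  Node := D.Node ⊕ ι
  finite := by
    have := D.finite
    infer_instance
  tree := D.tree.attach fun i => {p i}
  isTree := D.isTree.attach_leaves p
  bag := Sum.elim (fun x => Sum.inl '' D.bag x) (fun i => insert (Sum.inr i) (Sum.inl '' S i))
  exists_bag_of_adj := by
    rintro (v | i) (w | j) h
    · obtain ⟨x, hv, hw⟩ := D.exists_bag_of_adj v w h
      exact ⟨.inl x, by simpa using hv, by simpa using hw⟩
    · exact ⟨.inr j, by simpa using hs j h, by simp⟩
    · exact ⟨.inr i, by simp, by simpa using hs i h⟩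
    · exact (SimpleGraph.attach_adj_inr_inr h).elim
  connected_nodes := by
    rintro (v | i)
    · have hc := D.connected_nodes v
      obtain ⟨r⟩ := hc.nonempty
      rw [SimpleGraph.connected_iff_exists_forall_reachable]
      let e : D.tree.induce {x | v ∈ D.bag x} →g (D.tree.attach fun i => {p i}).induce
          {x | (Sum.inl v : V ⊕ ι) ∈ (Sum.elim (fun x => Sum.inl '' D.bag x)
            (fun i => insert (Sum.inr i) (Sum.inl '' S i)) : D.Node ⊕ ι → Set (V ⊕ ι)) x} :=
        ⟨fun x => ⟨.inl x.1, Set.mem_image_of_mem Sum.inl x.2⟩, fun h => h⟩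
      refine ⟨e r, ?_⟩
      rintro ⟨x | i, hx⟩
      · exact (hc.preconnected r ⟨x, by simpa using hx⟩).map e
      · have hv : v ∈ D.bag (p i) := hS i (by simpa using hx)
        refine ((hc.preconnected r ⟨p i, hv⟩).map e).trans (SimpleGraph.Adj.reachable ?_)
        exact Set.mem_singleton (p i)
    · have h1 : ∀ x : D.Node ⊕ ι, (Sum.inr i : V ⊕ ι) ∈ (Sum.elim (fun x => Sum.inl '' D.bag x)
            (fun i => insert (Sum.inr i) (Sum.inl '' S i)) : D.Node ⊕ ι → Set (V ⊕ ι)) x ↔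
            x = .inr i := by
        rintro (x | j) <;> simp [eq_comm]
      have : Nonempty {x : D.Node ⊕ ι | (Sum.inr i : V ⊕ ι) ∈
          (Sum.elim (fun x => Sum.inl '' D.bag x)
            (fun i => insert (Sum.inr i) (Sum.inl '' S i)) : D.Node ⊕ ι → Set (V ⊕ ι)) x} :=
        ⟨⟨.inr i, (h1 _).2 rfl⟩⟩
      have : Subsingleton {x : D.Node ⊕ ι | (Sum.inr i : V ⊕ ι) ∈
          (Sum.elim (fun x => Sum.inl '' D.bag x)
            (fun i => insert (Sum.inr i) (Sum.inl '' S i)) : D.Node ⊕ ι → Set (V ⊕ ι)) x} :=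
        ⟨fun a b => Subtype.ext (((h1 _).1 a.2).trans ((h1 _).1 b.2).symm)⟩
      exact SimpleGraph.Connected.of_subsingleton

/-- A triangle-free graph of treewidth at most `k` each of whose colourings of defect `d` has a
bag with a rainbow pair of potential at least `t`. -/
theorem exists_forall_isDefective_exists_isRainbowPair {k n : ℕ} (hn : 2 * n ≤ k + 2) (hnk : n ≤ k)
    (d t : ℕ) :
    ∃ (V : Type) (_ : Finite V) (G : SimpleGraph V) (D : TreeDecomposition G),
      G.CliqueFree 3 ∧ (∀ x, (D.bag x).ncard ≤ k + 1) ∧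
      ∀ f : V → Fin n, G.IsDefective f d → ∃ (x : D.Node) (I J : Finset V),
        G.IsRainbowPair f I J ∧ (I : Set V) ⊆ D.bag x ∧ (J : Set V) ⊆ D.bag x ∧
          t ≤ I.card * (n + 1) + J.card := by
  classical
  induction t with
  | zero =>
    refine ⟨Empty, inferInstance, ⊥, .trivial _, ?_, fun x => ?_, fun f _ =>
      ⟨(), ∅, ∅, ⟨?_, ?_, ?_, ?_, ?_, ?_, ?_⟩, ?_, ?_, ?_⟩⟩
    · exact SimpleGraph.cliqueFree_of_card_lt (by simp)
    · simp [TreeDecomposition.trivial]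
    all_goals simp [SimpleGraph.IsIndepSet]
  | succ t ih =>
    obtain ⟨V, hV, G, D, hG, hD, hcol⟩ := ih
    have := D.finite
    -- Every possible `(I, J)` is served in advance: a node, a part of its bag with room for a new
    -- vertex, an independent neighbourhood in it, and `k * d + 1` twins, enough for the pigeonhole
    -- with at most `k` neighbours.
    let ι := {q : D.Node × Set V × Set V × Fin (k * d + 1) //
      q.2.1 ⊆ D.bag q.1 ∧ q.2.1.ncard ≤ k ∧ q.2.2.1 ⊆ q.2.1 ∧ G.IsIndepSet q.2.2.1}
    let D' := D.attach (ι := ι) (fun i => i.1.1) (fun i => i.1.2.1) (fun i => i.1.2.2.1)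
      (fun i => i.2.1) (fun i => i.2.2.2.1)
    refine ⟨V ⊕ ι, inferInstance, G.attach _, D', ?_, ?_, ?_⟩
    · exact SimpleGraph.attach_cliqueFree_three hG fun i => i.2.2.2.2
    · rintro (x | i)
      · exact (Set.ncard_image_of_injective _ Sum.inl_injective).trans_le (hD x)
      · refine (Set.ncard_insert_le _ _).trans (Nat.add_le_add_right ?_ 1)
        exact (Set.ncard_image_of_injective _ Sum.inl_injective).trans_le i.2.2.1
    intro f hf
    let e := G.attachEmbedding fun i : ι => i.1.2.2.1
    obtain ⟨x, I, J, hIJ, hIx, hJx, ht⟩ := hcol (f ∘ e) (hf.comp_embedding e)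
    have hnew : ∀ S N : Finset V, (S : Set V) ⊆ D.bag x → S.card ≤ k → N ⊆ S →
        G.IsIndepSet (N : Set V) → ∃ i : ι, i.1.2.1 = S ∧ i.1.2.2.1 = N ∧
          f (.inr i) ∉ N.image (f ∘ e) := by
      intro S N hSx hS hNS hN
      let w : Fin (k * d + 1) → ι := fun j =>
        ⟨(x, S, N, j), hSx, (Set.ncard_coe_finset S).trans_le hS, by exact_mod_cast hNS, hN⟩
      have hcard : (N.map e.toEmbedding).card * d < k * d + 1 := by
        rw [Finset.card_map]
        exact Nat.lt_succ_of_le (Nat.mul_le_mul_right d ((Finset.card_le_card hNS).trans hS))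
      obtain ⟨j, hj⟩ := hf.exists_colour_notMem_image (N.map e.toEmbedding) hcard
        (fun j => .inr (w j))
        (fun a b hab => congrArg (fun i : ι => i.1.2.2.2) (Sum.inr_injective hab)) (fun j u hu => by
          obtain ⟨u, huN, rfl⟩ := Finset.mem_map.1 hu
          exact huN)
      refine ⟨w j, rfl, rfl, ?_⟩
      rwa [Finset.map_eq_image, Finset.image_image] at hj
    rcases hIJ.card_left_le.lt_or_eq with hlt | heq
    · have hcard : (I ∪ J).card ≤ k := by
        have h1 := Finset.card_union_le I J
        have h2 := hIJ.card_right_le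
        omega
      -- As `f(J) ⊆ f(I)`, this neighbourhood shows exactly the colours of `J`, so the new vertex
      -- avoids them without being adjacent to `J`.
      obtain ⟨i, hiS, hiN, hi⟩ := hnew (I ∪ J) (I.filter fun u => f (e u) ∈ J.image (f ∘ e))
        (by rw [Finset.coe_union]; exact Set.union_subset hIx hJx) hcard
        ((Finset.filter_subset _ _).trans Finset.subset_union_left)
        (hIJ.indep_left.mono (Finset.coe_subset.2 (Finset.filter_subset _ _)))
      have himage : (J.map e.toEmbedding).image f = J.image (f ∘ e) := by
        rw [Finset.map_eq_image, Finset.image_image]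
        rfl
      have hadj : ∀ u, (G.attach fun i : ι => i.1.2.2.1).Adj (.inr i) (e u) ↔
          u ∈ I ∧ f (e u) ∈ J.image (f ∘ e) := by
        intro u
        change u ∈ i.1.2.2.1 ↔ _
        rw [hiN]
        simp
      have hinl : ∀ K : Finset V, Sum.inr i ∉ K.map e.toEmbedding := by
        intro K hK
        obtain ⟨u, -, hu⟩ := Finset.mem_map.1 hK
        exact Sum.inl_ne_inr hu
      obtain ⟨I', J', hIJ', hI', hJ', hlt'⟩ := (hIJ.map e).exists_lt (hinl I) (hinl J)
        (fun u hu => by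
          obtain ⟨u, huI, rfl⟩ := Finset.mem_map.1 hu
          rw [himage]
          exact (hadj u).trans (and_iff_right huI))
        (fun u hu h => by
          obtain ⟨u, huJ, rfl⟩ := Finset.mem_map.1 hu
          exact Finset.disjoint_left.1 hIJ.disjoint ((hadj u).1 h).1 huJ)
        (by
          rw [himage]
          intro h
          obtain ⟨u, hu, huc⟩ := Finset.mem_image.1 (hIJ.image_subset h)
          refine hi (Finset.mem_image.2 ⟨u, Finset.mem_filter.2 ⟨hu, ?_⟩, huc⟩)
          rw [← huc] at h
          exact h)
      have hbag : ((insert (Sum.inr i) (I.map e.toEmbedding ∪ J.map e.toEmbedding) :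
          Finset (V ⊕ ι)) : Set (V ⊕ ι)) ⊆ D'.bag (.inr i) := by
        intro z hz
        change z ∈ insert (Sum.inr i) (Sum.inl '' i.1.2.1)
        rw [hiS]
        rw [← Finset.map_union, Finset.mem_coe, Finset.mem_insert] at hz
        rcases hz with rfl | hz
        · exact Set.mem_insert _ _
        · obtain ⟨u, hu, rfl⟩ := Finset.mem_map.1 hz
          exact Set.mem_insert_of_mem _ ⟨u, hu, rfl⟩
      refine ⟨.inr i, I', J', hIJ', (Finset.coe_subset.2 hI').trans hbag,
        (Finset.coe_subset.2 hJ').trans hbag, ?_⟩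
      simp only [Finset.card_map] at hlt'
      omega
    -- Here `I` shows all `n` colours, leaving none for a twin attached to `I`. The bound `n ≤ k`
    -- leaves room for it in a bag.
    · obtain ⟨i, -, -, hi⟩ := hnew I I hIx (by omega) subset_rfl hIJ.indep_left
      refine (hi ?_).elim
      have : I.image (f ∘ e) = Finset.univ := by
        rw [← Finset.card_eq_iff_eq_univ, Finset.card_image_of_injOn hIJ.injOn_left, heq,
          Fintype.card_fin]
      rw [this]
      exact Finset.mem_univ _

/-- The tree-decomposition of `G` induced by one of an isomorphic graph. -/
def TreeDecomposition.comap {V : Type} {W : Type u} {G : SimpleGraph V} {H : SimpleGraph W}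
    (D : TreeDecomposition G) (e : H ≃g G) : TreeDecomposition H where
  Node := D.Node
  finite := D.finite
  tree := D.tree
  isTree := D.isTree
  bag x := e ⁻¹' D.bag x
  exists_bag_of_adj _ _ h := D.exists_bag_of_adj _ _ (e.map_adj_iff.2 h)
  connected_nodes v := D.connected_nodes (e v)

theorem exists_forall_not_isDefective {k n : ℕ} (hn : 2 * n ≤ k + 2) (hnk : n ≤ k) (d : ℕ) :
    ∃ G ∈ triangleFreeTreewidthAtMost.{u} k, ∀ f : G.Vertex → Fin n,
      ¬ G.graph.IsDefective f d := by
  -- The requested potential exceeds by one the maximum allowed by `|J| ≤ |I| ≤ n`.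
  obtain ⟨V, hV, G, D, hG, hD, hcol⟩ :=
    exists_forall_isDefective_exists_isRainbowPair hn hnk d (n * (n + 1) + n + 1)
  let e : G.comap (Equiv.ulift.{u} : ULift V ≃ V) ≃g G := SimpleGraph.Iso.comap Equiv.ulift G
  refine ⟨⟨ULift.{u} V, inferInstance, G.comap Equiv.ulift⟩, ⟨?_, ?_⟩, ?_⟩
  · exact hG.comap e.toEmbedding.toCopy.isContained
  · refine treewidth_le_iff.2 ⟨D.comap e, fun x => ?_⟩
    refine le_trans ?_ (hD x)
    rw [← Set.ncard_image_of_injective _ e.injective]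
    exact Set.ncard_le_ncard (Set.image_preimage_subset _ _) (Set.toFinite _)
  · intro f hf
    have : Finite (ULift.{u} V) := inferInstance
    obtain ⟨x, I, J, hIJ, -, -, ht⟩ := hcol _ (hf.comp_embedding e.symm.toEmbedding)
    have h1 := hIJ.card_left_le
    have h2 := hIJ.card_right_le
    have h3 := Nat.mul_le_mul_right (n + 1) h1
    omega

/-! ### Comparing the notions of colouring -/

theorem HasDefect.isDefective {V : Type u} [Finite V] {G : SimpleGraph V} {n d : ℕ}
    {f : V → Fin n} (h : HasDefect G f d) : G.IsDefective f d := by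
  intro v
  let v' : {w | f w = f v} := ⟨v, rfl⟩
  let C := (colourClass G f (f v)).connectedComponentMk v'
  refine le_trans ?_ (h (f v) C ⟨v', rfl⟩)
  rw [← Set.ncard_image_of_injective _ (Subtype.val_injective.comp Subtype.val_injective)]
  refine Set.ncard_le_ncard ?_ (Set.toFinite _)
  rintro u ⟨hvu, hu⟩
  have hadj : (colourClass G f (f v)).Adj v' ⟨u, hu⟩ := hvu
  exact ⟨⟨⟨u, hu⟩, SimpleGraph.ConnectedComponent.sound hadj.symm.reachable⟩, hvu, rfl⟩

/-- The neighbours of `v` of its own colour all lie in its monochromatic component. -/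
theorem HasClustering.isDefective {V : Type u} [Finite V] {G : SimpleGraph V} {n c : ℕ}
    {f : V → Fin n} (h : HasClustering G f c) : G.IsDefective f c := by
  intro v
  let v' : {w | f w = f v} := ⟨v, rfl⟩
  refine le_trans ?_ (h (f v) ((colourClass G f (f v)).connectedComponentMk v'))
  rw [← Set.ncard_image_of_injective _ Subtype.val_injective]
  refine Set.ncard_le_ncard ?_ (Set.toFinite _)
  rintro u ⟨hvu, hu⟩
  have hadj : (colourClass G f (f v)).Adj v' ⟨u, hu⟩ := hvu
  exact ⟨⟨u, hu⟩, SimpleGraph.ConnectedComponent.sound hadj.symm.reachable, rfl⟩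

theorem colourClass_coloring_eq_bot {V : Type u} {G : SimpleGraph V} {n : ℕ}
    (f : G.Coloring (Fin n)) (i : Fin n) : colourClass G f i = ⊥ := by
  ext v w
  simp only [SimpleGraph.comap_adj, SimpleGraph.bot_adj, iff_false]
  exact fun h => f.valid h (v.2.trans w.2.symm)

theorem SimpleGraph.Coloring.hasDefect_zero {V : Type u} {G : SimpleGraph V} {n : ℕ}
    (f : G.Coloring (Fin n)) : HasDefect G f 0 := by
  intro i C v
  have h : C.toSimpleGraph.neighborSet v = ∅ := by
    refine Set.eq_empty_of_forall_notMem fun w hw => ?_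
    have hadj : (colourClass G f i).Adj v.1 w.1 := hw
    exact (colourClass_coloring_eq_bot f i).le hadj
  simp [h]

theorem SimpleGraph.Coloring.hasClustering_one {V : Type u} [Finite V] {G : SimpleGraph V} {n : ℕ}
    (f : G.Coloring (Fin n)) : HasClustering G f 1 := by
  intro i C
  refine Set.ncard_le_one_iff_subsingleton.2 ?_
  intro v hv w hw
  have hr : (colourClass G f i).Reachable v w :=
    SimpleGraph.ConnectedComponent.exact (hv.trans hw.symm)
  rwa [colourClass_coloring_eq_bot, SimpleGraph.reachable_bot] at hr

theorem SimpleGraph.IsDefective.comp_injective {V C C' : Type*} {G : SimpleGraph V} {f : V → C}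
    {d : ℕ} (h : G.IsDefective f d) {g : C → C'} (hg : Function.Injective g) :
    G.IsDefective (g ∘ f) d := by
  intro v
  simpa only [Function.comp_apply, hg.eq_iff] using h v

theorem SimpleGraph.Coloring.isDefective_zero {V C : Type*} {G : SimpleGraph V}
    (f : G.Coloring C) : G.IsDefective f 0 := by
  intro v
  have : {u | G.Adj v u ∧ f u = f v} = ∅ :=
    Set.eq_empty_of_forall_notMem fun u hu => f.valid hu.1 hu.2.symm
  simp [this]

theorem add_three_le_of_forall_exists_isDefective {k n d : ℕ} (hk : 1 ≤ k)
    (h : ∀ G ∈ triangleFreeTreewidthAtMost.{u} k, ∃ f : G.Vertex → Fin n,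
      G.graph.IsDefective f d) : k + 3 ≤ 2 * n := by
  by_contra hlt
  -- `k / 2 + 1` is the largest number of colours with `2n ≤ k + 2`. It is at most `k` because `k ≥
  -- 1`.
  obtain ⟨G, hG, hno⟩ :=
    exists_forall_not_isDefective.{u} (k := k) (n := k / 2 + 1) (by omega) (by omega) d
  obtain ⟨f, hf⟩ := h G hG
  exact hno _ (hf.comp_injective (Fin.castLE_injective (by omega : n ≤ k / 2 + 1)))

theorem natCeil_add_three_div_two_le_iff {k n : ℕ} :
    ⌈((k : ℚ) + 3) / 2⌉₊ ≤ n ↔ k + 3 ≤ 2 * n := by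
  rw [Nat.ceil_le, div_le_iff₀ two_pos, mul_comm]
  norm_cast

theorem mainTheorem2 (k : ℕ) (hk : 1 ≤ k) :
    defectiveChromaticNumber (triangleFreeTreewidthAtMost.{u} k) = (⌈((k : ℚ) + 3) / 2⌉₊ : ℕ∞) ∧
    clusteredChromaticNumber (triangleFreeTreewidthAtMost.{u} k) = (⌈((k : ℚ) + 3) / 2⌉₊ : ℕ∞) ∧
    classChromaticNumber (triangleFreeTreewidthAtMost.{u} k) = (⌈((k : ℚ) + 3) / 2⌉₊ : ℕ∞) := by
  have hcol : ∀ G ∈ triangleFreeTreewidthAtMost.{u} k,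
      G.graph.Colorable ⌈((k : ℚ) + 3) / 2⌉₊ := by
    rintro G ⟨hG, htw⟩
    have := G.finite
    exact colorable_of_treewidth_le hG (natCeil_add_three_div_two_le_iff.1 le_rfl) htw
  refine ⟨le_antisymm ?_ ?_, le_antisymm ?_ ?_, le_antisymm ?_ ?_⟩
  · refine sInf_le ⟨_, rfl, 0, fun G hG => ?_⟩
    obtain ⟨f⟩ := hcol G hG
    exact ⟨f, f.hasDefect_zero⟩
  · refine le_sInf ?_
    rintro _ ⟨n, rfl, d, h⟩
    rw [Nat.cast_le, natCeil_add_three_div_two_le_iff]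
    refine add_three_le_of_forall_exists_isDefective hk (d := d) fun G hG => ?_
    have := G.finite
    exact (h G hG).imp fun f hf => hf.isDefective
  · refine sInf_le ⟨_, rfl, 1, fun G hG => ?_⟩
    have := G.finite
    obtain ⟨f⟩ := hcol G hG
    exact ⟨f, f.hasClustering_one⟩
  · refine le_sInf ?_
    rintro _ ⟨n, rfl, c, h⟩
    rw [Nat.cast_le, natCeil_add_three_div_two_le_iff]
    refine add_three_le_of_forall_exists_isDefective hk (d := c) fun G hG => ?_
    have := G.finite
    exact (h G hG).imp fun f hf => hf.isDefective
  · exact iSup₂_le fun G hG => SimpleGraph.chromaticNumber_le_iff_colorable.2 (hcol G hG)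
  · refine ENat.forall_natCast_le_iff_le.1 fun m hm => ?_
    by_contra hlt
    -- A supremum below `m` is a finite `n`, and then every graph of the class is `n`-colourable.
    obtain ⟨n, hn⟩ := ENat.ne_top_iff_exists.1 (ne_top_of_lt (not_le.1 hlt))
    rw [← hn, Nat.cast_le, not_le] at hlt
    have h3 : k + 3 ≤ 2 * n := by
      refine add_three_le_of_forall_exists_isDefective.{u} hk (d := 0) fun G hG => ?_
      have hle : G.graph.chromaticNumber ≤ n := by
        rw [hn]
        exact le_iSup₂ (f := fun (G : FiniteGraph.{u})
          (_ : G ∈ triangleFreeTreewidthAtMost.{u} k) => G.graph.chromaticNumber) G hG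
      obtain ⟨f⟩ := SimpleGraph.chromaticNumber_le_iff_colorable.1 hle
      exact ⟨f, f.isDefective_zero⟩
    have h4 := natCeil_add_three_div_two_le_iff.2 h3
    have h5 : m ≤ ⌈((k : ℚ) + 3) / 2⌉₊ := by exact_mod_cast hm
    omega
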